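/- Let $n\ge 1$, and let all graphs be finite and simple. The degree partition of a graph on the vertex set $[n]=\{1,\dots,n\}$ is its degree sequence rearranged in weakly decreasing order (zero entries are kept). Let $\mathsf{DP}(n)\subset\mathbb R^n$ be the convex hull of the degree partitions of all $n$-vertex graphs. A graph is threshold if each of its nonempty induced subgraphs has a dominating vertex (one adjacent to all other vertices of the subgraph) or an isolated vertex; let $TP(n)\subset\mathbb R^n$ be the set of degree partitions of $n$-vertex threshold graphs. Let $\mathsf F(n)\subset\mathbb R^n$ be the Fulkerson–Hoffman–McAndrew polytope, i.e. the set of all $x\in\mathbb R^n$ with $x_1\ge x_2\ge\cdots\ge x_n$ and $$\sum_{i=1}^{k}x_i-\sum_{i=n-l+1}^{n}x_i\le k(n-1-l)\qquad\text{for all integers } k,l\ge 0 \text{ with } 1\le k+l\le n$$ (there are $n(n+3)/2$ such pairs $(k,l)$). Let $S(n)$ be the set of pairs $(i,j)$ with $1\le i<j\le n$, ordered by $(i,j)\le(i',j')$ iff $i\le i'$ and $j\le j'$. Let $\mathsf S(n)\subset\mathbb R^{S(n)}$ be its order polytope, the set of $y\in[0,1]^{S(n)}$ with $y_p\ge y_q$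 whenever $p<q$, and let $M(n)$ be the $n\times\binom n2$ matrix whose column indexed by $(i,j)\in S(n)$ is the characteristic vector of $\{i,j\}\subseteq[n]$. Then: 1. $\mathsf{DP}(n)=\mathsf F(n)$, and the number of pairs $(k,l)$ above is $n(n+3)/2$, so $\mathsf F(n)$ is given by quadratically many inequalities. 2. The set of extreme points of $\mathsf{DP}(n)=\mathsf F(n)$ is exactly $TP(n)$, and it has $2^{n-1}$ elements. 3. The image of $\mathsf S(n)$ under the linear map $y\mapsto M(n)y$ is $\mathsf{DP}(n)$. -/

import Mathlib

namespace DegreePartition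

/-- `G` is threshold: every (nonempty) induced subgraph of `G` has a vertex adjacent to all its
other vertices (dominating), or a vertex adjacent to none of its vertices (isolated). -/
def IsThreshold {V : Type*} (G : SimpleGraph V) : Prop :=
  ∀ s : Set V, s.Nonempty →
    ∃ v : s, (G.induce s).IsUniversal v ∨ (G.induce s).IsIsolated v

open Classical in
/-- `d` is the degree partition of `G`: the rearrangement of the degree sequence of `G` in weakly
decreasing order. -/
def IsDegreePartition {n : ℕ} (G : SimpleGraph (Fin n)) (d : Fin n → ℕ) : Prop :=
  Antitone d ∧ ∃ σ : Equiv.Perm (Fin n), ∀ i, d i = G.degree (σ i)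

/-- The set `DP(n)` of all degree partitions of `n`-vertex simple graphs, as points of `ℝⁿ`. -/
def degreePartitions (n : ℕ) : Set (Fin n → ℝ) :=
  {x | ∃ (G : SimpleGraph (Fin n)) (d : Fin n → ℕ), IsDegreePartition G d ∧ ∀ i, x i = d i}

/-- The set `TP(n)` of all degree partitions of `n`-vertex threshold graphs, as points of `ℝⁿ`. -/
def thresholdPartitions (n : ℕ) : Set (Fin n → ℝ) :=
  {x | ∃ (G : SimpleGraph (Fin n)) (d : Fin n → ℕ),
    IsThreshold G ∧ IsDegreePartition G d ∧ ∀ i, x i = d i}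

/-- The polytope of degree partitions. -/
def degreePartitionPolytope (n : ℕ) : Set (Fin n → ℝ) :=
  convexHull ℝ (degreePartitions n)

/-- The pairs `(k, l)` of natural numbers with `1 ≤ k + l ≤ n`. -/
def fhmIndices (n : ℕ) : Finset (ℕ × ℕ) :=
  (Finset.range (n + 1) ×ˢ Finset.range (n + 1)).filter
    fun p => 1 ≤ p.1 + p.2 ∧ p.1 + p.2 ≤ n

/-- The Fulkerson–Hoffman–McAndrew polytope. Coordinates are numbered from `0`, so the first `k`
coordinates are those with `i < k`, and the last `l` are those with `n ≤ i + l`. -/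
def fhmPolytope (n : ℕ) : Set (Fin n → ℝ) :=
  {x | (∀ i j : Fin n, i ≤ j → x j ≤ x i) ∧
    ∀ p ∈ fhmIndices n,
      (∑ i : Fin n with i.val < p.1, x i) - (∑ i : Fin n with n ≤ i.val + p.2, x i)
        ≤ (p.1 : ℝ) * ((n : ℝ) - 1 - (p.2 : ℝ))}

/-- The order polytope of a poset (with the order-reversing convention). -/
def orderPolytope (P : Type*) [PartialOrder P] : Set (P → ℝ) :=
  {x | (∀ p q : P, p < q → x q ≤ x p) ∧ ∀ p : P, 0 ≤ x p ∧ x p ≤ 1}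

/-- The 2-subsets of `[n]`, written as pairs `(i, j)` with `i < j`; the order is the one inherited
from the product, i.e. the componentwise order. -/
abbrev TwoSubset (n : ℕ) : Type := {p : Fin n × Fin n // p.1 < p.2}

/-- The `n × (n choose 2)` incidence matrix of singletons vs. doubletons in `[n]`. -/
def incidenceMatrix (n : ℕ) : Matrix (Fin n) (TwoSubset n) ℝ :=
  Matrix.of fun i e => if i = e.val.1 ∨ i = e.val.2 then 1 else 0

end DegreePartition

/-! Graphs are relaxed to fractional graphs, i.e. edge weights in [0,1]. Their degree vectors form a
compact convex set R, cut out by one inequality for each pair of disjoint vertex sets (A, B)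
(`mem_rowSum_image_fractionalGraphs`). By Hahn–Banach this is a bound on each linear functional `c`
by its maximum over R. That maximum is additive when `c` is peeled into multiples of sign vectors,
and on sign vectors the bound is the (A, B) inequality. For decreasing x the worst A and B are an
initial and a final segment, so F(n) lies in R.

A decreasing vector of R is realized by a shifted fractional graph, namely one with least sum of
squares (`mem_rowSum_image_shifted`). Read above the diagonal, shifted fractional graphs are the
points of the order polytope, and row sums become multiplication by M(n). Their extreme points are
0/1, i.e. shifted graphs, so F(n) is the convex hull of the degree vectors of shifted graphs.

A threshold graph is the unique maximizer of some vertex weighting among fractional graphs, so its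
sorted degree vector is extreme in F(n). Hence threshold partitions ⊆ extreme points ⊆ shifted
degree vectors ⊆ threshold partitions, and all three agree. Shifted graphs are determined by their
degrees, and each vertex after the first doubles their number. -/

namespace DegreePartition

/-! ### Fractional graphs -/

section Fractional

variable {V : Type*}

/-- A fractional graph: a symmetric matrix with entries in `[0, 1]` and zero diagonal. -/
def fractionalGraphs (V : Type*) : Set (V → V → ℝ) :=
  {w | (∀ i j, w i j = w j i) ∧ (∀ i, w i i = 0) ∧ ∀ i j, 0 ≤ w i j ∧ w i j ≤ 1}

/-- The degree vector of a fractional graph, as a linear map. -/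
def rowSum (V : Type*) [Fintype V] : (V → V → ℝ) →ₗ[ℝ] (V → ℝ) where
  toFun w i := ∑ j, w i j
  map_add' w w' := by ext i; simp [Finset.sum_add_distrib]
  map_smul' r w := by ext i; simp [Finset.mul_sum]

theorem rowSum_apply [Fintype V] (w : V → V → ℝ) (i : V) : rowSum V w i = ∑ j, w i j := rfl

theorem convex_fractionalGraphs : Convex ℝ (fractionalGraphs V) := by
  rintro w ⟨h1, h2, h3⟩ w' ⟨h1', h2', h3'⟩ a b ha hb hab
  refine ⟨fun i j => ?_, fun i => ?_, fun i j => ⟨?_, ?_⟩⟩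
  · simp [h1 i j, h1' i j]
  · simp [h2 i, h2' i]
  · have := mul_nonneg ha (h3 i j).1
    have := mul_nonneg hb (h3' i j).1
    simp only [Pi.add_apply, Pi.smul_apply, smul_eq_mul]
    linarith
  · have := mul_le_mul_of_nonneg_left (h3 i j).2 ha
    have := mul_le_mul_of_nonneg_left (h3' i j).2 hb
    simp only [Pi.add_apply, Pi.smul_apply, smul_eq_mul]
    linarith

theorem isClosed_fractionalGraphs : IsClosed (fractionalGraphs V) := by
  simp only [fractionalGraphs, Set.ofPred_and, Set.ofPred_forall]
  refine .inter (isClosed_iInter fun i => isClosed_iInter fun j => ?_)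
    (.inter (isClosed_iInter fun i => ?_) (isClosed_iInter fun i => isClosed_iInter fun j => ?_))
  · exact isClosed_eq (by fun_prop) (by fun_prop)
  · exact isClosed_eq (by fun_prop) (by fun_prop)
  · exact (isClosed_le (by fun_prop) (by fun_prop)).inter (isClosed_le (by fun_prop) (by fun_prop))

theorem isCompact_fractionalGraphs : IsCompact (fractionalGraphs V) := by
  refine (isCompact_Icc (a := (0 : V → V → ℝ)) (b := 1)).of_isClosed_subset
    isClosed_fractionalGraphs ?_
  rintro w ⟨-, -, h⟩
  exact ⟨fun i j => (h i j).1, fun i j => (h i j).2⟩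

theorem continuous_rowSum [Fintype V] : Continuous (rowSum V) := by
  refine continuous_pi fun i => ?_
  simp only [rowSum_apply]
  fun_prop

/-- The weight between A and B is at most the degree sum of B. Apart from it, each vertex of A meets
only the n - 1 - |B| other vertices outside B, with weight at most 1 each. -/
theorem sum_rowSum_sub_sum_rowSum_le [Fintype V] [DecidableEq V] {w : V → V → ℝ}
    (hw : w ∈ fractionalGraphs V) {A B : Finset V} (hAB : Disjoint A B) :
    ∑ i ∈ A, rowSum V w i - ∑ i ∈ B, rowSum V w i ≤
      (A.card : ℝ) * ((Fintype.card V : ℝ) - 1 - B.card) := by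
  obtain ⟨hs, hd, hb⟩ := hw
  have h1 : ∀ i ∈ A, rowSum V w i - ∑ j ∈ B, w i j ≤ (Fintype.card V : ℝ) - 1 - B.card := by
    intro i hi
    have hiB : i ∈ Bᶜ := by
      rw [Finset.mem_compl]
      exact Finset.disjoint_left.mp hAB hi
    have h2 : rowSum V w i - ∑ j ∈ B, w i j = ∑ j ∈ Bᶜ.erase i, w i j := by
      rw [rowSum_apply, ← Finset.sum_add_sum_compl B, ← Finset.add_sum_erase _ _ hiB, hd]
      ring
    have h3 : ((Bᶜ.erase i).card : ℝ) = (Fintype.card V : ℝ) - 1 - B.card := by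
      have h4 := Finset.card_erase_add_one hiB
      have h5 := Finset.card_add_card_compl B
      have : (Bᶜ.erase i).card + 1 + B.card = Fintype.card V := by omega
      have h6 : ((Bᶜ.erase i).card : ℝ) + 1 + B.card = Fintype.card V := by exact_mod_cast this
      linarith
    rw [h2, ← h3]
    have := Finset.sum_le_card_nsmul (Bᶜ.erase i) (w i) 1 fun j _ => (hb i j).2
    simpa using this
  have h2 : ∑ i ∈ A, ∑ j ∈ B, w i j ≤ ∑ j ∈ B, rowSum V w j := by
    rw [Finset.sum_comm]
    refine Finset.sum_le_sum fun j _ => ?_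
    rw [rowSum_apply]
    simp only [fun i => hs i j]
    exact Finset.sum_le_sum_of_subset_of_nonneg (Finset.subset_univ _) fun i _ _ => (hb j i).1
  have h3 := Finset.sum_le_card_nsmul A _ _ h1
  rw [Finset.sum_sub_distrib, nsmul_eq_mul] at h3
  linarith

/-- The linear functional `c` on degree vectors, as a symmetric functional on fractional graphs. -/
theorem two_mul_sum_mul_rowSum [Fintype V] (c : V → ℝ) {w : V → V → ℝ}
    (hw : ∀ i j, w i j = w j i) :
    2 * ∑ i, c i * rowSum V w i = ∑ i, ∑ j, (c i + c j) * w i j := by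
  have h1 : ∑ i, c i * rowSum V w i = ∑ i, ∑ j, c i * w i j := by
    simp only [rowSum_apply, Finset.mul_sum]
  have h2 : ∑ i, c i * rowSum V w i = ∑ i, ∑ j, c j * w i j := by
    rw [h1, Finset.sum_comm]
    simp only [fun i j => hw j i]
  rw [two_mul]
  nth_rw 1 [h1]
  rw [h2]
  simp only [← Finset.sum_add_distrib, add_mul]

end Fractional

/-! ### Weights of threshold graphs -/

section Threshold

variable {V : Type*}

/-- `c` separates the edges from the non-edges of `G` on the vertices in `s`. -/
def IsSeparatingWeight (G : SimpleGraph V) (c : V → ℝ) (s : Set V) : Prop :=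
  ∀ i ∈ s, ∀ j ∈ s, i ≠ j → (G.Adj i j → 0 < c i + c j) ∧ (¬ G.Adj i j → c i + c j < 0)

/-- Peel off a dominating or isolated vertex and give it a weight, positive or negative, whose
absolute value exceeds that of every other weight. -/
theorem IsThreshold.exists_isSeparatingWeight_coe {G : SimpleGraph V} (hG : IsThreshold G)
    (s : Finset V) : ∃ c, IsSeparatingWeight G c s := by
  classical
  induction s using Finset.strongInduction with
  | H s ih =>
    rcases s.eq_empty_or_nonempty with rfl | hs
    · exact ⟨0, by simp [IsSeparatingWeight]⟩
    obtain ⟨⟨v, hv⟩, h⟩ := hG s hs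
    obtain ⟨c, hc⟩ := ih (s.erase v) (Finset.erase_ssubset hv)
    have hbd : ∀ i ∈ s, |c i| ≤ ∑ j ∈ s, |c j| := fun i hi =>
      Finset.single_le_sum (f := fun j => |c j|) (fun j _ => abs_nonneg _) hi
    have key : ∀ a : ℝ, (∀ j ∈ s, j ≠ v →
        (G.Adj v j → 0 < a + c j) ∧ (¬ G.Adj v j → a + c j < 0)) →
        ∃ c, IsSeparatingWeight G c s := by
      intro a ha
      refine ⟨Function.update c v a, fun i hi j hj hij => ?_⟩
      by_cases hiv : i = v
      · subst hiv
        simpa [Function.update_of_ne hij.symm] using ha j hj hij.symm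
      by_cases hjv : j = v
      · subst hjv
        simpa [Function.update_of_ne hij, add_comm, G.adj_comm] using ha i hi hij
      simpa [Function.update_of_ne hiv, Function.update_of_ne hjv] using
        hc i (by simp_all) j (by simp_all) hij
    rcases h with h | h
    · refine key (1 + ∑ j ∈ s, |c j|) fun j hj hjv => ⟨fun _ => ?_, fun hn => ?_⟩
      · have := hbd j hj
        have := neg_abs_le (c j)
        linarith
      · refine absurd ?_ hn
        have := @h ⟨j, hj⟩ (by simpa using hjv.symm)
        simpa using this
    · refine key (-(1 + ∑ j ∈ s, |c j|)) fun j hj hjv => ⟨fun hn => ?_, fun _ => ?_⟩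
      · refine absurd ?_ (h ⟨j, hj⟩)
        simpa using hn
      · have := hbd j hj
        have := le_abs_self (c j)
        linarith

theorem IsThreshold.exists_isSeparatingWeight [Fintype V] {G : SimpleGraph V}
    (hG : IsThreshold G) : ∃ c, IsSeparatingWeight G c Set.univ := by
  simpa using hG.exists_isSeparatingWeight_coe Finset.univ

open Classical in
/-- The adjacency matrix, as a fractional graph. -/
noncomputable def indicator (G : SimpleGraph V) (i j : V) : ℝ := if G.Adj i j then 1 else 0

theorem indicator_mem_fractionalGraphs (G : SimpleGraph V) :
    indicator G ∈ fractionalGraphs V := by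
  refine ⟨fun i j => by classical exact if_congr (G.adj_comm i j) rfl rfl, fun i => by simp [indicator],
    fun i j => ?_⟩
  unfold indicator
  split_ifs <;> norm_num

theorem indicator_injective : Function.Injective (indicator : SimpleGraph V → V → V → ℝ) := by
  intro G H h
  ext i j
  have := congrFun (congrFun h i) j
  unfold indicator at this
  split_ifs at this <;> simp_all

open Classical in
theorem rowSum_indicator [Fintype V] (G : SimpleGraph V) (i : V) :
    rowSum V (indicator G) i = G.degree i := by
  simp [rowSum_apply, indicator, ← SimpleGraph.card_neighborFinset_eq_degree,
    SimpleGraph.neighborFinset_eq_filter]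

/-- Off the diagonal `c i + c j` is never zero, so each entry has a unique optimal value, that of
the adjacency matrix. A sum that is not smaller then forces equality in every entry. -/
theorem IsSeparatingWeight.eq_indicator [Fintype V] {G : SimpleGraph V} {c : V → ℝ}
    (hc : IsSeparatingWeight G c Set.univ) {w : V → V → ℝ} (hw : w ∈ fractionalGraphs V)
    (h : ∑ i, c i * rowSum V (indicator G) i ≤ ∑ i, c i * rowSum V w i) : w = indicator G := by
  have hG := indicator_mem_fractionalGraphs G
  have hle : ∀ i j, (c i + c j) * w i j ≤ (c i + c j) * indicator G i j ∧
      ((c i + c j) * w i j = (c i + c j) * indicator G i j → w i j = indicator G i j) := by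
    intro i j
    by_cases hij : i = j
    · subst hij
      simp [hw.2.1, hG.2.1]
    have hc' := hc i trivial j trivial hij
    by_cases ha : G.Adj i j
    · have := hc'.1 ha
      refine ⟨mul_le_mul_of_nonneg_left ?_ this.le, fun h => mul_left_cancel₀ this.ne' h⟩
      simpa [indicator, ha] using (hw.2.2 i j).2
    · have := hc'.2 ha
      refine ⟨mul_le_mul_of_nonpos_left ?_ this.le, fun h => mul_left_cancel₀ this.ne h⟩
      simpa [indicator, ha] using (hw.2.2 i j).1
  have h' : ∑ i, ∑ j, (c i + c j) * indicator G i j ≤ ∑ i, ∑ j, (c i + c j) * w i j := by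
    rw [← two_mul_sum_mul_rowSum c hG.1, ← two_mul_sum_mul_rowSum c hw.1]
    linarith
  have h1 := le_antisymm
    (Finset.sum_le_sum fun i _ => Finset.sum_le_sum fun j _ => (hle i j).1) h'
  rw [Finset.sum_eq_sum_iff_of_le
    (fun i _ => Finset.sum_le_sum fun j _ => (hle i j).1)] at h1
  ext i j
  have h2 := h1 i (Finset.mem_univ _)
  rw [Finset.sum_eq_sum_iff_of_le (fun j _ => (hle i j).1)] at h2
  exact (hle i j).2 (h2 j (Finset.mem_univ _))

end Threshold

/-! ### The support function of the polytope of fractional degree vectors -/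

section Support

/-- The share of the vertex of weight `a` in the positive part of `a + b`. -/
noncomputable def halfPosPart (a b : ℝ) : ℝ := max 0 (min a (a + b))

/-- The two shares of a pair make up its whole contribution to the maximum of the functional. The
asymmetric split lets sign vectors be evaluated row by row. -/
theorem halfPosPart_add_halfPosPart (a b : ℝ) :
    halfPosPart a b + halfPosPart b a = max 0 (a + b) := by
  unfold halfPosPart
  rw [add_comm b a]
  rcases le_total 0 a with ha | ha <;> rcases le_total 0 b with hb | hb
  · rw [min_eq_left (by linarith), min_eq_left (by linarith), max_eq_right ha, max_eq_right hb,
      max_eq_right (by linarith)]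
  · rw [min_eq_right (by linarith), min_eq_left (by linarith), max_eq_left hb, add_zero]
  · rw [min_eq_left (by linarith), min_eq_right (by linarith), max_eq_left ha, zero_add]
  · rw [min_eq_right (by linarith), min_eq_right (by linarith), max_eq_left (by linarith),
      add_zero]

/-- `halfPosPart` is additive under moving all nonzero weights towards zero by `m`. -/
theorem halfPosPart_eq_add {a b m : ℝ} (ha : a = 0 ∨ m ≤ |a|) (hb : b = 0 ∨ m ≤ |b|) :
    halfPosPart a b = m * halfPosPart (SignType.sign a) (SignType.sign b) +
      halfPosPart (a - m * SignType.sign a) (b - m * SignType.sign b) := by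
  unfold halfPosPart
  rcases lt_trichotomy a 0 with h | h | h
  · rw [abs_of_neg h] at ha
    rcases ha with ha | ha
    · linarith
    simp only [sign_neg h, SignType.coe_neg_one]
    rw [max_eq_left ((min_le_left _ _).trans h.le),
      max_eq_left ((min_le_left _ _).trans (by norm_num)),
      max_eq_left ((min_le_left _ _).trans (by linarith))]
    ring
  · subst h
    simp
  · rw [abs_of_pos h] at ha
    rcases ha with ha | ha
    · linarith
    rcases lt_trichotomy b 0 with h' | h' | h'
    · simp only [sign_neg h', sign_pos h, SignType.coe_neg_one, SignType.coe_one]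
      rw [abs_of_neg h'] at hb
      rcases hb with hb | hb
      · linarith
      rw [min_eq_right (by linarith), min_eq_right (by linarith), min_eq_right (by linarith)]
      norm_num
    · subst h'
      simp [sign_pos h, h.le, ha]
    · simp only [sign_pos h', sign_pos h, SignType.coe_one]
      rw [abs_of_pos h'] at hb
      rcases hb with hb | hb
      · linarith
      rw [min_eq_left (by linarith), min_eq_left (by linarith), min_eq_left (by linarith),
        max_eq_right h.le, max_eq_right (by linarith), max_eq_right (by linarith)]
      ring

variable {V : Type*} [Fintype V] [DecidableEq V]

/-- The maximum of the linear functional `c` over all fractional degree vectors. -/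
noncomputable def supportFun (c : V → ℝ) : ℝ :=
  ∑ i, ∑ j ∈ Finset.univ.erase i, halfPosPart (c i) (c j)

theorem supportFun_eq_add {c : V → ℝ} {m : ℝ} (hc : ∀ i, c i = 0 ∨ m ≤ |c i|) :
    supportFun c = m * supportFun (fun i => (SignType.sign (c i) : ℝ)) +
      supportFun (fun i => c i - m * SignType.sign (c i)) := by
  unfold supportFun
  rw [Finset.mul_sum, ← Finset.sum_add_distrib]
  refine Finset.sum_congr rfl fun i _ => ?_
  rw [Finset.mul_sum, ← Finset.sum_add_distrib]
  exact Finset.sum_congr rfl fun j _ => halfPosPart_eq_add (hc i) (hc j)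

/-- Only rows with `0 < c i` contribute, one unit for each other vertex of nonnegative weight. This
is the right-hand side of the inequality for A = {c > 0}, B = {c < 0}. -/
theorem supportFun_sign (c : V → ℝ) :
    supportFun (fun i => (SignType.sign (c i) : ℝ)) =
      (Finset.card {i | 0 < c i} : ℝ) *
        ((Fintype.card V : ℝ) - 1 - (Finset.card {i | c i < 0} : ℝ)) := by
  have h : ∀ i, ∑ j ∈ Finset.univ.erase i,
      halfPosPart (SignType.sign (c i)) (SignType.sign (c j)) =
      if 0 < c i then ((Fintype.card V : ℝ) - 1 - (Finset.card {i | c i < 0} : ℝ)) else 0 := by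
    intro i
    split_ifs with hi
    · have h1 : ∀ j, halfPosPart (SignType.sign (c i)) (SignType.sign (c j)) =
          1 - if c j < 0 then 1 else 0 := by
        intro j
        unfold halfPosPart
        rw [sign_pos hi]
        rcases lt_trichotomy (c j) 0 with h | h | h
        · simp [sign_neg h, h]
        · simp [h]
        · simp [sign_pos h, not_lt.mpr h.le]
      simp only [h1, Finset.sum_sub_distrib]
      rw [Finset.sum_erase (f := fun j => if c j < 0 then (1 : ℝ) else 0) _ (by simp [hi.le])]
      simp [Finset.card_erase_of_mem, Nat.cast_sub (Fintype.card_pos_iff.mpr ⟨i⟩)]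
    · refine Finset.sum_eq_zero fun j _ => max_eq_left ((min_le_left _ _).trans ?_)
      rcases lt_or_eq_of_le (not_lt.mp hi) with h | h
      · simp [sign_neg h]
      · simp [h]
  unfold supportFun
  simp only [h]
  rw [← Finset.sum_filter, Finset.sum_const, nsmul_eq_mul]

/-- It suffices to bound a linear functional by `supportFun` on sign vectors. -/
theorem sum_mul_le_supportFun {x : V → ℝ}
    (hx : ∀ A B : Finset V, Disjoint A B → ∑ i ∈ A, x i - ∑ i ∈ B, x i ≤
      (A.card : ℝ) * ((Fintype.card V : ℝ) - 1 - B.card)) (c : V → ℝ) :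
    ∑ i, c i * x i ≤ supportFun c := by
  have hsign : ∀ c : V → ℝ, ∑ i, (SignType.sign (c i) : ℝ) * x i ≤
      supportFun (fun i => (SignType.sign (c i) : ℝ)) := by
    intro c
    rw [supportFun_sign]
    refine le_of_eq_of_le ?_ (hx _ _ ?_)
    · rw [Finset.sum_filter, Finset.sum_filter, ← Finset.sum_sub_distrib]
      refine Finset.sum_congr rfl fun i _ => ?_
      rcases lt_trichotomy (c i) 0 with h | h | h
      · simp [sign_neg h, h, not_lt.mpr h.le]
      · simp [h]
      · simp [sign_pos h, h, not_lt.mpr h.le]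
    · rw [Finset.disjoint_filter]
      intro i _ h
      exact not_lt.mpr h.le
  -- Induction on the support of `c`: subtracting the least nonzero absolute value times the sign
  -- vector kills at least one coordinate and creates none.
  induction hs : (Finset.univ.filter fun i => c i ≠ 0) using Finset.strongInduction
    generalizing c with
  | H s ih =>
    rcases s.eq_empty_or_nonempty with rfl | hne
    · have : c = 0 := by
        ext i
        simpa using Finset.filter_eq_empty_iff.mp hs (Finset.mem_univ i)
      subst this
      simp [supportFun, halfPosPart]
    obtain ⟨a, ha, hmin⟩ := s.exists_min_image (fun i => |c i|) hne
    have hc : ∀ i, c i = 0 ∨ |c a| ≤ |c i| := by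
      intro i
      by_cases hi : c i = 0
      · exact .inl hi
      · exact .inr (hmin i (by simp [← hs, hi]))
    have hlt : (Finset.univ.filter fun i => c i - |c a| * SignType.sign (c i) ≠ 0) ⊂ s := by
      refine Finset.ssubset_iff_subset_ne.mpr ⟨fun i hi => ?_, fun h => ?_⟩
      · rw [← hs, Finset.mem_filter]
        refine ⟨Finset.mem_univ _, fun h0 => ?_⟩
        simp [h0] at hi
      · rw [← h] at ha
        simp at ha
    have h1 := ih _ hlt _ rfl
    have h2 := mul_le_mul_of_nonneg_left (hsign c) (abs_nonneg (c a))
    rw [supportFun_eq_add hc]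
    refine le_of_eq_of_le ?_ (add_le_add h2 h1)
    rw [Finset.mul_sum, ← Finset.sum_add_distrib]
    exact Finset.sum_congr rfl fun i _ => by ring

/-- The maximum is attained by placing weight 1 exactly on the pairs with `0 < c i + c j`. -/
theorem exists_sum_mul_rowSum_eq_supportFun (c : V → ℝ) :
    ∃ w ∈ fractionalGraphs V, ∑ i, c i * rowSum V w i = supportFun c := by
  let w : V → V → ℝ := fun i j => if i ≠ j ∧ 0 < c i + c j then 1 else 0
  have hw : w ∈ fractionalGraphs V := by
    refine ⟨fun i j => ?_, fun i => by simp [w], fun i j => ?_⟩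
    · simp only [w, ne_comm (a := i), add_comm (c i)]
    · simp only [w]
      split_ifs <;> norm_num
  refine ⟨w, hw, ?_⟩
  have h : 2 * supportFun c = ∑ i, ∑ j, (c i + c j) * w i j := by
    have h1 : supportFun c = ∑ i, ∑ j, if i = j then 0 else halfPosPart (c i) (c j) := by
      refine Finset.sum_congr rfl fun i _ => ?_
      rw [← Finset.sum_erase (a := i) (f := fun j => if i = j then 0 else halfPosPart (c i) (c j))
        Finset.univ (by simp)]
      refine Finset.sum_congr rfl fun j hj => ?_
      rw [if_neg (Finset.ne_of_mem_erase hj).symm]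
    have h2 : supportFun c = ∑ i, ∑ j, if i = j then 0 else halfPosPart (c j) (c i) := by
      rw [h1, Finset.sum_comm]
      simp only [eq_comm]
    rw [two_mul]
    nth_rw 1 [h1]
    rw [h2]
    simp only [← Finset.sum_add_distrib]
    refine Finset.sum_congr rfl fun i _ => Finset.sum_congr rfl fun j _ => ?_
    by_cases hij : i = j
    · simp [hij, w]
    · rw [if_neg hij, if_neg hij, halfPosPart_add_halfPosPart]
      by_cases hp : 0 < c i + c j
      · simp [w, hij, hp, hp.le]
      · simp [w, hij, hp, not_lt.mp hp]
  have := two_mul_sum_mul_rowSum c hw.1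
  linarith

/-- The fractional degree vectors are cut out by the inequalities indexed by pairs of disjoint
sets of vertices. -/
theorem mem_rowSum_image_fractionalGraphs {x : V → ℝ}
    (hx : ∀ A B : Finset V, Disjoint A B → ∑ i ∈ A, x i - ∑ i ∈ B, x i ≤
      (A.card : ℝ) * ((Fintype.card V : ℝ) - 1 - B.card)) :
    x ∈ rowSum V '' fractionalGraphs V := by
  by_contra hn
  obtain ⟨f, u, hf, hu⟩ := geometric_hahn_banach_closed_point
    (convex_fractionalGraphs.linear_image (rowSum V))
    (isCompact_fractionalGraphs.image continuous_rowSum).isClosed hn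
  have hfz : ∀ z : V → ℝ, f z = ∑ i, f (Pi.single i 1) * z i := by
    intro z
    conv_lhs => rw [← Finset.univ_sum_single z, map_sum]
    refine Finset.sum_congr rfl fun i _ => ?_
    have : Pi.single i (z i) = z i • (Pi.single i 1 : V → ℝ) := by
      rw [← Pi.single_smul, smul_eq_mul, mul_one]
    rw [this, map_smul, smul_eq_mul, mul_comm]
  obtain ⟨w, hw, hwc⟩ := exists_sum_mul_rowSum_eq_supportFun fun i => f (Pi.single i 1)
  have h1 := hf _ ⟨w, hw, rfl⟩
  have h2 := sum_mul_le_supportFun hx fun i => f (Pi.single i 1)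
  rw [hfz] at h1 hu
  linarith

end Support

/-! ### Sorted vectors -/

/-- The level `t` separates `C` from its complement, and `A \ C` and `C \ A` have equal size. -/
theorem sum_le_sum_of_card_eq {V : Type*} [DecidableEq V] {x : V → ℝ} {A C : Finset V} {t : ℝ}
    (hC : ∀ i ∈ C, t ≤ x i) (hC' : ∀ i ∉ C, x i ≤ t) (h : A.card = C.card) :
    ∑ i ∈ A, x i ≤ ∑ i ∈ C, x i := by
  rw [← Finset.sum_sdiff_le_sum_sdiff]
  have h1 := Finset.sum_le_card_nsmul (A \ C) x t fun i hi => hC' i (Finset.mem_sdiff.mp hi).2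
  have h2 := Finset.card_nsmul_le_sum (C \ A) x t fun i hi => hC i (Finset.mem_sdiff.mp hi).1
  rw [Finset.card_sdiff_comm h] at h1
  exact h1.trans h2

theorem card_fin_filter_lt {n k : ℕ} (hk : k ≤ n) :
    (Finset.univ.filter fun i : Fin n => i.val < k).card = k := by
  rw [Fin.card_filter_val_lt, min_eq_right hk]

theorem card_fin_filter_le_add {n l : ℕ} (hl : l ≤ n) :
    (Finset.univ.filter fun i : Fin n => n ≤ i.val + l).card = l := by
  have h := Finset.card_filter_add_card_filter_not (s := (Finset.univ : Finset (Fin n)))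
    (fun i : Fin n => i.val < n - l)
  rw [card_fin_filter_lt (Nat.sub_le _ _), Finset.card_univ, Fintype.card_fin] at h
  have h2 : (Finset.univ.filter fun i : Fin n => n ≤ i.val + l) =
      Finset.univ.filter fun i : Fin n => ¬ i.val < n - l := by
    ext i
    simp only [Finset.mem_filter, Finset.mem_univ, true_and]
    omega
  rw [h2]
  omega

theorem sum_le_sum_filter_lt {n : ℕ} {x : Fin n → ℝ} (hx : Antitone x) (A : Finset (Fin n)) :
    ∑ i ∈ A, x i ≤ ∑ i : Fin n with i.val < A.card, x i := by
  have hA : A.card ≤ n := by simpa using A.card_le_univ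
  rcases hA.eq_or_lt with h | h
  · have : A = Finset.univ := by rw [← Finset.card_eq_iff_eq_univ, h, Fintype.card_fin]
    subst this
    simp
  · refine sum_le_sum_of_card_eq (t := x ⟨A.card, h⟩) (fun i hi => hx ?_) (fun i hi => hx ?_) ?_
    · rw [Fin.le_def]
      simp only [Finset.mem_filter, Finset.mem_univ, true_and] at hi
      exact hi.le
    · rw [Fin.le_def]
      simpa using hi
    · rw [card_fin_filter_lt hA]

theorem sum_filter_le_add_le_sum {n : ℕ} {x : Fin n → ℝ} (hx : Antitone x) (B : Finset (Fin n)) :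
    ∑ i : Fin n with n ≤ i.val + B.card, x i ≤ ∑ i ∈ B, x i := by
  have hB : B.card ≤ n := by simpa using B.card_le_univ
  rcases hB.eq_or_lt with h | h
  · have : B = Finset.univ := by rw [← Finset.card_eq_iff_eq_univ, h, Fintype.card_fin]
    subst this
    simp
  · have := sum_le_sum_of_card_eq (x := fun i => - x i) (A := B)
      (C := Finset.univ.filter fun i : Fin n => n ≤ i.val + B.card)
      (t := - x ⟨n - 1 - B.card, by omega⟩) (fun i hi => neg_le_neg (hx ?_))
      (fun i hi => neg_le_neg (hx ?_)) ?_
    · simpa using this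
    · rw [Fin.le_def]
      simp only [Finset.mem_filter, Finset.mem_univ, true_and] at hi
      simp only
      omega
    · rw [Fin.le_def]
      simp only [Finset.mem_filter, Finset.mem_univ, true_and] at hi
      simp only
      omega
    · rw [card_fin_filter_le_add hB]

theorem fhmPolytope_subset_rowSum_image (n : ℕ) :
    fhmPolytope n ⊆ rowSum (Fin n) '' fractionalGraphs (Fin n) := by
  rintro x ⟨hanti, hx⟩
  have hanti : Antitone x := fun i j h => hanti i j h
  refine mem_rowSum_image_fractionalGraphs fun A B hAB => ?_
  -- The pair (0, 0) is not among the indices of the polytope; its inequality is trivial.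
  by_cases h0 : A.card + B.card = 0
  · have hA : A = ∅ := by rw [← Finset.card_eq_zero]; omega
    have hB : B = ∅ := by rw [← Finset.card_eq_zero]; omega
    simp [hA, hB]
  have hcard : A.card + B.card ≤ n := by
    rw [← Finset.card_union_of_disjoint hAB]
    simpa using (A ∪ B).card_le_univ
  have := hx (A.card, B.card) (by simp [fhmIndices]; omega)
  rw [Fintype.card_fin]
  linarith [sum_le_sum_filter_lt hanti A, sum_filter_le_add_le_sum hanti B]

theorem mem_fhmPolytope_of_antitone {n : ℕ} {w : Fin n → Fin n → ℝ}
    (hw : w ∈ fractionalGraphs (Fin n)) (σ : Equiv.Perm (Fin n))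
    (h : Antitone fun i => rowSum (Fin n) w (σ i)) :
    (fun i => rowSum (Fin n) w (σ i)) ∈ fhmPolytope n := by
  refine ⟨fun i j hij => h hij, fun p hp => ?_⟩
  simp only [fhmIndices, Finset.mem_filter] at hp
  have h1 := sum_rowSum_sub_sum_rowSum_le hw
    (A := (Finset.univ.filter fun i : Fin n => i.val < p.1).map σ.toEmbedding)
    (B := (Finset.univ.filter fun i : Fin n => n ≤ i.val + p.2).map σ.toEmbedding) (by
      rw [Finset.disjoint_map, Finset.disjoint_filter]
      intro i _
      omega)
  simpa only [Finset.sum_map, Finset.card_map, card_fin_filter_lt (show p.1 ≤ n by omega),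
    card_fin_filter_le_add (show p.2 ≤ n by omega), Fintype.card_fin, Equiv.coe_toEmbedding] using h1

/-! ### Shifted fractional graphs -/

section Shifted

variable {n : ℕ}

/-- The fractional graphs on `Fin n` whose entries decrease along each row, off the diagonal. -/
def shiftedFractionalGraphs (n : ℕ) : Set (Fin n → Fin n → ℝ) :=
  {w | w ∈ fractionalGraphs (Fin n) ∧ ∀ i j k, i < j → k ≠ i → k ≠ j → w j k ≤ w i k}

theorem convex_shiftedFractionalGraphs : Convex ℝ (shiftedFractionalGraphs n) := by
  rintro w ⟨h, hs⟩ w' ⟨h', hs'⟩ a b ha hb hab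
  refine ⟨convex_fractionalGraphs h h' ha hb hab, fun i j k hij hi hj => ?_⟩
  exact add_le_add (mul_le_mul_of_nonneg_left (hs i j k hij hi hj) ha)
    (mul_le_mul_of_nonneg_left (hs' i j k hij hi hj) hb)

theorem isCompact_shiftedFractionalGraphs : IsCompact (shiftedFractionalGraphs n) := by
  refine isCompact_fractionalGraphs.of_isClosed_subset ?_ fun w hw => hw.1
  refine isClosed_fractionalGraphs.inter (s₂ := {w : Fin n → Fin n → ℝ |
    ∀ i j k, i < j → k ≠ i → k ≠ j → w j k ≤ w i k}) ?_
  simp only [Set.ofPred_forall]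
  exact isClosed_iInter fun i => isClosed_iInter fun j => isClosed_iInter fun k =>
    isClosed_iInter fun _ => isClosed_iInter fun _ => isClosed_iInter fun _ =>
      isClosed_le (by fun_prop) (by fun_prop)

/-- Rows of a fractional graph are compared after exchanging their diagonal entries. -/
theorem apply_swap_le {V : Type*} [DecidableEq V] {w : V → V → ℝ} (hw : w ∈ fractionalGraphs V)
    {i j : V} (h : ∀ k, k ≠ i → k ≠ j → w j k ≤ w i k) (k : V) :
    w j (Equiv.swap i j k) ≤ w i k := by
  by_cases hi : k = i
  · subst hi
    rw [Equiv.swap_apply_left, hw.2.1, hw.2.1]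
  by_cases hj : k = j
  · subst hj
    rw [Equiv.swap_apply_right, hw.1]
  rw [Equiv.swap_apply_of_ne_of_ne hi hj]
  exact h k hi hj

theorem antitone_rowSum {w : Fin n → Fin n → ℝ} (hw : w ∈ shiftedFractionalGraphs n) :
    Antitone (rowSum (Fin n) w) := by
  intro i j hij
  rcases hij.eq_or_lt with rfl | hij
  · exact le_rfl
  rw [rowSum_apply, rowSum_apply, ← Equiv.sum_comp (Equiv.swap i j)]
  exact Finset.sum_le_sum fun k _ => apply_swap_le hw.1 (fun k hi hj => hw.2 i j k hij hi hj) k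

/-- Row `j` exceeds row `i` in column `k`. Without a column compensating for this, row `j` would
have the larger sum. -/
theorem exists_lt_of_rowSum_le {V : Type*} [Fintype V] [DecidableEq V] {w : V → V → ℝ}
    (hw : w ∈ fractionalGraphs V) {i j k : V} (hi : k ≠ i) (hj : k ≠ j)
    (hle : rowSum V w j ≤ rowSum V w i) (hlt : w i k < w j k) :
    ∃ m, m ≠ i ∧ m ≠ j ∧ w j m < w i m := by
  by_contra! hn
  have h1 : ∑ m, w i (Equiv.swap j i m) < ∑ m, w j m := by
    refine Finset.sum_lt_sum (fun m _ => apply_swap_le hw (fun m hj hi => hn m hi hj) m)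
      ⟨k, Finset.mem_univ _, ?_⟩
    rwa [Equiv.swap_apply_of_ne_of_ne hj hi]
  rw [Equiv.sum_comp (Equiv.swap j i)] at h1
  exact not_lt.mpr hle h1

/-- Transferring weight `ε` around the alternating cycle `i k j m`. -/
theorem exists_transfer {V : Type*} [Fintype V] [DecidableEq V] {w : V → V → ℝ}
    (hw : w ∈ fractionalGraphs V) {i j k m : V} (hij : i ≠ j) (hki : k ≠ i) (hkj : k ≠ j)
    (hmi : m ≠ i) (hmj : m ≠ j) (hk : w i k < w j k) (hm : w j m < w i m) :
    ∃ w' ∈ fractionalGraphs V, rowSum V w' = rowSum V w ∧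
      ∑ a, ∑ b, w' a b ^ 2 < ∑ a, ∑ b, w a b ^ 2 := by
  have hkm : k ≠ m := by
    rintro rfl
    exact lt_asymm hk hm
  obtain ⟨hs, hd, hb⟩ := hw
  -- Half the smaller gap: the two entries in each column move towards each other without crossing,
  -- so they stay in [0, 1] and the sum of squares drops by at least 8ε².
  obtain ⟨ε, hε, hεk, hεm⟩ : ∃ ε > 0, 2 * ε ≤ w j k - w i k ∧ 2 * ε ≤ w i m - w j m := by
    refine ⟨min (w j k - w i k) (w i m - w j m) / 2, ?_, ?_, ?_⟩
    · exact half_pos (lt_min (by linarith) (by linarith))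
    · linarith [min_le_left (w j k - w i k) (w i m - w j m)]
    · linarith [min_le_right (w j k - w i k) (w i m - w j m)]
  let u : V → ℝ := Pi.single i 1 - Pi.single j 1
  let v : V → ℝ := Pi.single k 1 - Pi.single m 1
  have hu : ∀ f : V → ℝ, ∑ a, u a * f a = f i - f j := by
    intro f
    simp [u, sub_mul, Finset.sum_sub_distrib, Pi.single_apply]
  have hv : ∀ f : V → ℝ, ∑ a, v a * f a = f k - f m := by
    intro f
    simp [v, sub_mul, Finset.sum_sub_distrib, Pi.single_apply]
  have hu1 : ∑ a, u a = 0 := by simpa using hu 1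
  have hv1 : ∑ a, v a = 0 := by simpa using hv 1
  have huv : ∀ a, u a * v a = 0 := by
    intro a
    by_cases h1 : a = i
    · subst h1
      simp [v, hki.symm, hmi.symm]
    by_cases h2 : a = j
    · subst h2
      simp [v, hkj.symm, hmj.symm]
    simp [u, h1, h2]
  -- The signed 4-cycle. Its row sums vanish since `u` and `v` sum to zero, and its diagonal
  -- vanishes since their supports are disjoint.
  let D : V → V → ℝ := fun a b => u a * v b + v a * u b
  have hD : ∀ f : V → V → ℝ, (∀ a b, f a b = f b a) →
      ∑ a, ∑ b, D a b * f a b = 2 * (f i k - f i m - f j k + f j m) := by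
    intro f hf
    have h1 : ∑ a, ∑ b, u a * v b * f a b = f i k - f i m - f j k + f j m := by
      simp only [mul_assoc, ← Finset.mul_sum, hv, hu]
      ring
    have h2 : ∑ a, ∑ b, v a * u b * f a b = f i k - f i m - f j k + f j m := by
      simp only [mul_assoc, ← Finset.mul_sum, hv, hu]
      rw [hf k i, hf m i, hf k j, hf m j]
      ring
    simp only [D, add_mul, Finset.sum_add_distrib, h1, h2]
    ring
  have hDs : ∀ a b, D a b = D b a := fun a b => by simp only [D]; ring
  have hik : D i k = 1 := by simp [D, u, v, hij, hki, hkm, hki.symm, hmi.symm]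
  have him : D i m = -1 := by simp [D, u, v, hij, hmi, hkm.symm, hki.symm, hmi.symm]
  have hjk : D j k = -1 := by simp [D, u, v, hij.symm, hkj, hkm, hkj.symm, hmj.symm]
  have hjm : D j m = 1 := by simp [D, u, v, hij.symm, hmj, hkm.symm, hkj.symm, hmj.symm]
  have hbound : ∀ a b, v a = 0 → 0 ≤ w a b + ε * D a b ∧ w a b + ε * D a b ≤ 1 := by
    intro a b ha
    by_cases hua : u a = 0
    · simpa [D, ha, hua] using hb a b
    by_cases hvb : v b = 0
    · simpa [D, ha, hvb] using hb a b
    have ha' : a = i ∨ a = j := by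
      by_contra! h
      simp [u, h.1, h.2] at hua
    have hb' : b = k ∨ b = m := by
      by_contra! h
      simp [v, h.1, h.2] at hvb
    have := hb i k
    have := hb j k
    have := hb i m
    have := hb j m
    rcases ha' with rfl | rfl <;> rcases hb' with rfl | rfl
    · rw [hik]; constructor <;> linarith
    · rw [him]; constructor <;> linarith
    · rw [hjk]; constructor <;> linarith
    · rw [hjm]; constructor <;> linarith
  have hsymm : ∀ a b, w a b + ε * D a b = w b a + ε * D b a := fun a b => by
    rw [hs a b, hDs a b]
  refine ⟨fun a b => w a b + ε * D a b, ⟨hsymm, fun a => ?_, fun a b => ?_⟩, ?_, ?_⟩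
  · have := huv a
    simp only [hd, D]
    linear_combination 2 * ε * this
  · by_cases ha : v a = 0
    · exact hbound a b ha
    by_cases hb' : v b = 0
    · simp only [hsymm a b]
      exact hbound b a hb'
    have hua : u a = 0 := (mul_eq_zero.mp (huv a)).resolve_right ha
    have hub : u b = 0 := (mul_eq_zero.mp (huv b)).resolve_right hb'
    simpa [D, hua, hub] using hb a b
  · ext a
    simp only [rowSum_apply, D, Finset.sum_add_distrib, ← Finset.mul_sum, hu1, hv1]
    ring
  · have h1 : ∑ a, ∑ b, (w a b + ε * D a b) ^ 2 = ∑ a, ∑ b, w a b ^ 2 +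
        2 * ε * ∑ a, ∑ b, D a b * w a b + ε ^ 2 * ∑ a, ∑ b, D a b * D a b := by
      simp only [Finset.mul_sum, ← Finset.sum_add_distrib]
      exact Finset.sum_congr rfl fun a _ => Finset.sum_congr rfl fun b _ => by ring
    rw [h1, hD w hs, hD D hDs, hik, him, hjk, hjm]
    nlinarith

/-- A sorted fractional degree vector is realized by a shifted fractional graph. -/
theorem mem_rowSum_image_shifted {x : Fin n → ℝ} (hx : Antitone x)
    (h : x ∈ rowSum (Fin n) '' fractionalGraphs (Fin n)) :
    x ∈ rowSum (Fin n) '' shiftedFractionalGraphs n := by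
  obtain ⟨w₀, hw₀, hx₀⟩ := h
  have hcomp : IsCompact (fractionalGraphs (Fin n) ∩ rowSum (Fin n) ⁻¹' {x}) :=
    isCompact_fractionalGraphs.inter_right (isClosed_singleton.preimage continuous_rowSum)
  -- A minimizer of the sum of squares in the fibre over `x` must be shifted, since a violation
  -- would allow a transfer that lowers the sum.
  obtain ⟨w, ⟨hw, hwx⟩, hmin⟩ := hcomp.exists_isMinOn ⟨w₀, hw₀, hx₀⟩
    (f := fun w => ∑ a, ∑ b, w a b ^ 2) (by fun_prop)
  refine ⟨w, ⟨hw, fun i j k hij hi hj => ?_⟩, hwx⟩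
  by_contra! hlt
  have hle : rowSum (Fin n) w j ≤ rowSum (Fin n) w i := by
    rw [show rowSum (Fin n) w = x from hwx]
    exact hx hij.le
  obtain ⟨m, hmi, hmj, hm⟩ := exists_lt_of_rowSum_le hw hi hj hle hlt
  obtain ⟨w', hw', hr, hlt'⟩ := exists_transfer hw hij.ne hi hj hmi hmj hlt hm
  exact not_le.mpr hlt' (hmin ⟨hw', by rw [Set.mem_preimage, hr]; exact hwx⟩)

theorem rowSum_image_shiftedFractionalGraphs :
    rowSum (Fin n) '' shiftedFractionalGraphs n = fhmPolytope n := by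
  refine Set.Subset.antisymm ?_ fun x hx => mem_rowSum_image_shifted
    (fun i j hij => hx.1 i j hij) (fhmPolytope_subset_rowSum_image n hx)
  rintro _ ⟨w, hw, rfl⟩
  exact mem_fhmPolytope_of_antitone hw.1 (Equiv.refl _) (antitone_rowSum hw)

/-! ### Extreme points of the shifted fractional graphs -/

/-- If a value `t` strictly between 0 and 1 occurred, moving all entries equal to `t` up or down
together by a small amount would preserve every constraint and exhibit `w` as a midpoint. -/
theorem eq_zero_or_one_of_mem_extremePoints {w : Fin n → Fin n → ℝ}
    (hw : w ∈ Set.extremePoints ℝ (shiftedFractionalGraphs n)) (a b : Fin n) :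
    w a b = 0 ∨ w a b = 1 := by
  by_contra! hne
  obtain ⟨⟨⟨hs, hd, hb⟩, hm⟩, hext⟩ := mem_extremePoints.mp hw
  set t := w a b with ht
  -- `ε` will be the distance from `t` to the other entries and to the bounds 0 and 1, so the moved
  -- level overtakes none of them.
  let S : Finset ℝ := {0, 1} ∪ Finset.univ.image fun p : Fin n × Fin n => w p.1 p.2
  obtain ⟨ε, hε, hS⟩ : ∃ ε > 0, ∀ s ∈ S, s ≠ t → ε ≤ |s - t| := by
    obtain ⟨s₀, hs₀, hmin⟩ := (S.erase t).exists_min_image (fun s => |s - t|)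
      ⟨0, by simp [S, hne.1.symm]⟩
    exact ⟨|s₀ - t|, abs_pos.mpr (sub_ne_zero.mpr (Finset.ne_of_mem_erase hs₀)),
      fun s hs hst => hmin s (Finset.mem_erase.mpr ⟨hst, hs⟩)⟩
  have hSw : ∀ i j, w i j ≠ t → ε ≤ |w i j - t| := fun i j =>
    hS _ (Finset.mem_union_right _ (Finset.mem_image.mpr ⟨(i, j), Finset.mem_univ _, rfl⟩))
  have h0 : ε ≤ |0 - t| := hS 0 (by simp [S]) hne.1.symm
  have h1 : ε ≤ |1 - t| := hS 1 (by simp [S]) hne.2.symm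
  rw [zero_sub, abs_neg, abs_of_nonneg (hb a b).1] at h0
  rw [abs_of_nonneg (sub_nonneg.mpr (hb a b).2)] at h1
  let E : Fin n → Fin n → ℝ := fun i j => if w i j = t then 1 else 0
  have key : ∀ r, |r| ≤ ε → w + r • E ∈ shiftedFractionalGraphs n := by
    intro r hr
    obtain ⟨hr1, hr2⟩ := abs_le.mp hr
    refine ⟨⟨fun i j => ?_, fun i => ?_, fun i j => ?_⟩, fun i j k hij hi hj => ?_⟩
    · simp [E, hs i j]
    · simp [E, hd i, hne.1.symm]
    · by_cases h : w i j = t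
      · simp only [Pi.add_apply, Pi.smul_apply, smul_eq_mul, E, h, if_true]
        constructor <;> linarith
      · simpa [E, h] using hb i j
    · have hle := hm i j k hij hi hj
      simp only [Pi.add_apply, Pi.smul_apply, smul_eq_mul, E]
      by_cases h : w j k = t <;> by_cases h' : w i k = t
      · simp [h, h']
      · have h2 := hSw i k h'
        rw [abs_of_nonneg (by linarith)] at h2
        simp only [h, h', if_true, if_false]
        linarith
      · have h2 := hSw j k h
        rw [abs_of_nonpos (by linarith)] at h2
        simp only [h, h', if_true, if_false]
        linarith
      · simpa [h, h'] using hle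
  have := (hext _ (key ε (abs_of_pos hε).le) _ (key (-ε) (by rw [abs_neg, abs_of_pos hε]))
    ⟨1 / 2, 1 / 2, by norm_num, by norm_num, by norm_num, by module⟩).1
  have := congrFun (congrFun this a) b
  simp [E, ← ht, hε.ne'] at this

/-- A graph on `Fin n` is shifted if replacing an endpoint of an edge by a smaller vertex gives an
edge again. -/
def IsShifted (G : SimpleGraph (Fin n)) : Prop :=
  ∀ i j k, i < j → k ≠ i → G.Adj j k → G.Adj i k

/-- The degree vectors of shifted graphs. -/
def shiftedDegrees (n : ℕ) : Set (Fin n → ℝ) :=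
  (fun G => rowSum (Fin n) (indicator G)) '' {G : SimpleGraph (Fin n) | IsShifted G}

theorem IsShifted.indicator_mem {G : SimpleGraph (Fin n)} (hG : IsShifted G) :
    indicator G ∈ shiftedFractionalGraphs n := by
  refine ⟨indicator_mem_fractionalGraphs G, fun i j k hij hi _ => ?_⟩
  unfold indicator
  split_ifs with h1 h2
  · exact le_rfl
  · exact absurd (hG i j k hij hi h1) h2
  · exact zero_le_one
  · exact le_rfl

/-- Krein–Milman; the closure is harmless because the hull of a finite set is closed. -/
theorem shiftedFractionalGraphs_subset_convexHull :
    shiftedFractionalGraphs n ⊆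
      convexHull ℝ (indicator '' {G : SimpleGraph (Fin n) | IsShifted G}) := by
  have hcl : IsClosed (convexHull ℝ (indicator '' {G : SimpleGraph (Fin n) | IsShifted G})) :=
    ((Set.toFinite _).image _).isClosed_convexHull ℝ
  conv_lhs => rw [← closure_convexHull_extremePoints isCompact_shiftedFractionalGraphs
    convex_shiftedFractionalGraphs]
  refine closure_minimal (convexHull_mono fun w hw => ?_) hcl
  have h01 := eq_zero_or_one_of_mem_extremePoints hw
  obtain ⟨⟨hs, hd, hb⟩, hm⟩ := hw.1
  refine ⟨⟨fun i j => w i j = 1, ⟨fun i j h => by rw [hs, h]⟩, ⟨fun i h => ?_⟩⟩, ?_, ?_⟩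
  · simp [hd] at h
  · intro i j k hij hi (h : w j k = 1)
    have hj : k ≠ j := by
      rintro rfl
      simp [hd] at h
    have := hm i j k hij hi hj
    exact le_antisymm (hb i k).2 (by linarith)
  · ext i j
    rcases h01 i j with h | h <;> simp [indicator, h]

theorem fhmPolytope_eq_convexHull_shiftedDegrees :
    fhmPolytope n = convexHull ℝ (shiftedDegrees n) := by
  have h := (rowSum (Fin n)).image_convexHull (indicator '' {G : SimpleGraph (Fin n) | IsShifted G})
  rw [Set.image_image] at h
  rw [shiftedDegrees, ← h, ← rowSum_image_shiftedFractionalGraphs]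
  refine Set.Subset.antisymm (Set.image_mono shiftedFractionalGraphs_subset_convexHull)
    (Set.image_mono (convexHull_min ?_ convex_shiftedFractionalGraphs))
  rintro _ ⟨G, hG, rfl⟩
  exact IsShifted.indicator_mem hG

end Shifted

/-! ### Threshold graphs and extreme points -/

section Extreme

variable {n : ℕ}

/-- Test the smallest vertex `a` of `s` against the largest `b`: if they are adjacent, `a`
dominates, otherwise `b` is isolated. -/
theorem IsShifted.isThreshold {G : SimpleGraph (Fin n)} (hG : IsShifted G) : IsThreshold G := by
  intro s hs
  obtain ⟨a, ha, hmin⟩ := Set.exists_min_image s id (Set.toFinite s) hs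
  obtain ⟨b, hb, hmax⟩ := Set.exists_max_image s id (Set.toFinite s) hs
  have key : ∀ i j k, i ≤ j → k ≠ i → G.Adj j k → G.Adj i k := by
    intro i j k hij hki h
    rcases hij.eq_or_lt with rfl | hij
    · exact h
    · exact hG i j k hij hki h
  by_cases hab : G.Adj a b
  · refine ⟨⟨a, ha⟩, .inl ?_⟩
    rintro ⟨c, hc⟩ hac
    have hac : a ≠ c := by simpa using hac
    exact (key c b a (hmax c hc) hac hab.symm).symm
  · refine ⟨⟨b, hb⟩, .inr ?_⟩
    rintro ⟨c, hc⟩ hbc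
    have hbc : G.Adj b c := by simpa using hbc
    refine hab ?_
    by_cases hba : b = a
    · subst hba
      have : c = b := le_antisymm (hmax c hc) (hmin c hc)
      exact absurd this.symm hbc.ne
    · exact key a c b (hmin c hc) hba hbc.symm

theorem shiftedDegrees_subset_thresholdPartitions :
    shiftedDegrees n ⊆ thresholdPartitions n := by
  classical
  rintro _ ⟨G, hG, rfl⟩
  refine ⟨G, fun i => G.degree i, IsShifted.isThreshold hG, ⟨fun i j hij => ?_, Equiv.refl _,
    fun i => ?_⟩, fun i => ?_⟩
  · have := antitone_rowSum (IsShifted.indicator_mem hG) hij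
    rw [rowSum_indicator, rowSum_indicator] at this
    convert Nat.cast_le.mp this
  · simp only [Equiv.refl_apply]
    congr!
  · simp only [rowSum_indicator]

theorem thresholdPartitions_subset_degreePartitions :
    thresholdPartitions n ⊆ degreePartitions n := fun _ ⟨G, d, _, h⟩ => ⟨G, d, h⟩

theorem eq_rowSum_of_isDegreePartition {G : SimpleGraph (Fin n)} {d : Fin n → ℕ}
    {σ : Equiv.Perm (Fin n)} {x : Fin n → ℝ}
    (hσ : ∀ i, (d i : ℝ) = rowSum (Fin n) (indicator G) (σ i)) (hx : ∀ i, x i = d i) :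
    x = rowSum (Fin n) (indicator (G.comap σ)) := by
  ext i
  rw [hx, hσ, rowSum_apply, rowSum_apply, ← Equiv.sum_comp σ]
  rfl

theorem degreePartitions_subset_fhmPolytope : degreePartitions n ⊆ fhmPolytope n := by
  classical
  rintro x ⟨G, d, ⟨hd, σ, hσ⟩, hx⟩
  have hx' : x = fun i => rowSum (Fin n) (indicator G) (σ i) := by
    ext i
    rw [hx, hσ, rowSum_indicator]
  rw [hx']
  refine mem_fhmPolytope_of_antitone (indicator_mem_fractionalGraphs G) σ ?_
  rw [← hx']
  intro i j hij
  rw [hx, hx]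
  exact_mod_cast hd hij

theorem IsSeparatingWeight.rowSum_mem_extremePoints {V : Type*} [Fintype V] {G : SimpleGraph V}
    {c : V → ℝ} (hc : IsSeparatingWeight G c Set.univ) :
    rowSum V (indicator G) ∈ Set.extremePoints ℝ (rowSum V '' fractionalGraphs V) := by
  rw [mem_extremePoints_iff_left]
  refine ⟨⟨_, indicator_mem_fractionalGraphs G, rfl⟩, ?_⟩
  rintro _ ⟨w, hw, rfl⟩ _ ⟨w', hw', rfl⟩ ⟨s, t, hs, ht, hst, h⟩
  have hsum : ∑ i, c i * rowSum V (indicator G) i =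
      s * ∑ i, c i * rowSum V w i + t * ∑ i, c i * rowSum V w' i := by
    rw [← h, Finset.mul_sum, Finset.mul_sum, ← Finset.sum_add_distrib]
    refine Finset.sum_congr rfl fun i _ => ?_
    simp only [Pi.add_apply, Pi.smul_apply, smul_eq_mul]
    ring
  by_cases hle : ∑ i, c i * rowSum V (indicator G) i ≤ ∑ i, c i * rowSum V w i
  · rw [hc.eq_indicator hw hle]
  · push Not at hle
    have hle' : ∑ i, c i * rowSum V w' i ≤ ∑ i, c i * rowSum V (indicator G) i := by
      by_contra! hlt
      rw [hc.eq_indicator hw' hlt.le] at hlt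
      exact lt_irrefl _ hlt
    have h1 := mul_lt_mul_of_pos_left hle hs
    have h2 := mul_le_mul_of_nonneg_left hle' ht.le
    have h3 : s * ∑ i, c i * rowSum V (indicator G) i + t * ∑ i, c i * rowSum V (indicator G) i =
        ∑ i, c i * rowSum V (indicator G) i := by rw [← add_mul, hst, one_mul]
    linarith

/-- After relabelling by the sorting permutation, the vector is extreme already among all fractional
degree vectors, and extremality passes to the smaller set. -/
theorem thresholdPartitions_subset_extremePoints :
    thresholdPartitions n ⊆ Set.extremePoints ℝ (fhmPolytope n) := by
  classical
  rintro x ⟨G, d, hG, hd, hx⟩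
  have hmem : x ∈ fhmPolytope n := degreePartitions_subset_fhmPolytope ⟨G, d, hd, hx⟩
  obtain ⟨-, σ, hσ⟩ := hd
  obtain ⟨c, hc⟩ := hG.exists_isSeparatingWeight
  have hx' := eq_rowSum_of_isDegreePartition (G := G) (σ := σ)
    (fun i => by rw [hσ, rowSum_indicator]) hx
  have hc' : IsSeparatingWeight (G.comap σ) (c ∘ σ) Set.univ := fun i _ j _ hij =>
    hc (σ i) trivial (σ j) trivial (σ.injective.ne hij)
  refine inter_extremePoints_subset_extremePoints_of_subset (fhmPolytope_subset_rowSum_image n)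
    ⟨hmem, ?_⟩
  rw [hx']
  exact hc'.rowSum_mem_extremePoints

theorem extremePoints_fhmPolytope_subset :
    Set.extremePoints ℝ (fhmPolytope n) ⊆ shiftedDegrees n := by
  rw [fhmPolytope_eq_convexHull_shiftedDegrees]
  exact extremePoints_convexHull_subset

theorem thresholdPartitions_eq_shiftedDegrees : thresholdPartitions n = shiftedDegrees n :=
  (thresholdPartitions_subset_extremePoints.trans extremePoints_fhmPolytope_subset).antisymm
    shiftedDegrees_subset_thresholdPartitions

theorem degreePartitionPolytope_eq_fhmPolytope : degreePartitionPolytope n = fhmPolytope n := by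
  rw [fhmPolytope_eq_convexHull_shiftedDegrees]
  refine Set.Subset.antisymm (convexHull_min ?_ (convex_convexHull ℝ _)) (convexHull_mono
    (shiftedDegrees_subset_thresholdPartitions.trans thresholdPartitions_subset_degreePartitions))
  rw [← fhmPolytope_eq_convexHull_shiftedDegrees]
  exact degreePartitions_subset_fhmPolytope

theorem extremePoints_fhmPolytope :
    Set.extremePoints ℝ (fhmPolytope n) = thresholdPartitions n :=
  Set.Subset.antisymm
    (extremePoints_fhmPolytope_subset.trans shiftedDegrees_subset_thresholdPartitions)
    thresholdPartitions_subset_extremePoints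

end Extreme

/-! ### Counting shifted graphs -/

section Count

variable {n : ℕ}

/-- Equal degrees give equal values of the separating weight of `G`, whose maximizer is unique. -/
theorem IsShifted.eq_of_rowSum_eq {G H : SimpleGraph (Fin n)} (hG : IsShifted G)
    (h : rowSum (Fin n) (indicator G) = rowSum (Fin n) (indicator H)) : G = H := by
  obtain ⟨c, hc⟩ := hG.isThreshold.exists_isSeparatingWeight
  exact indicator_injective
    (hc.eq_indicator (indicator_mem_fractionalGraphs H) (by rw [h])).symm

/-- Add an isolated last vertex. -/
def addIsolated (G : SimpleGraph (Fin n)) : SimpleGraph (Fin (n + 1)) :=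
  G.map Fin.castSuccEmb

/-- Add a dominating first vertex. -/
def addDominating (G : SimpleGraph (Fin n)) : SimpleGraph (Fin (n + 1)) :=
  (Gᶜ.map (Fin.succEmb n))ᶜ

theorem addIsolated_injective : Function.Injective (addIsolated (n := n)) :=
  SimpleGraph.map_injective _

theorem addDominating_injective : Function.Injective (addDominating (n := n)) :=
  compl_injective.comp ((SimpleGraph.map_injective _).comp compl_injective)

theorem addIsolated_adj_castSucc {G : SimpleGraph (Fin n)} {i j : Fin n} :
    (addIsolated G).Adj i.castSucc j.castSucc ↔ G.Adj i j :=
  SimpleGraph.map_adj_apply (f := Fin.castSuccEmb)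

theorem not_addIsolated_adj_last {G : SimpleGraph (Fin n)} {i : Fin (n + 1)} :
    ¬ (addIsolated G).Adj (Fin.last n) i := by
  rintro ⟨-, a, b, -, h, -⟩
  exact (Fin.castSucc_lt_last a).ne h

theorem addDominating_adj_succ {G : SimpleGraph (Fin n)} {i j : Fin n} :
    (addDominating G).Adj i.succ j.succ ↔ G.Adj i j := by
  have := SimpleGraph.map_adj_apply (f := Fin.succEmb n) (G := Gᶜ) (a := i) (b := j)
  rw [addDominating, SimpleGraph.compl_adj]
  change _ ∧ ¬ (Gᶜ.map (Fin.succEmb n)).Adj (Fin.succEmb n i) (Fin.succEmb n j) ↔ _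
  rw [this, SimpleGraph.compl_adj, Fin.succ_inj.ne]
  constructor
  · rintro ⟨h1, h2⟩
    by_contra h
    exact h2 ⟨h1, h⟩
  · exact fun h => ⟨h.ne, fun h' => h'.2 h⟩

theorem addDominating_adj_zero {G : SimpleGraph (Fin n)} {i : Fin (n + 1)} (hi : i ≠ 0) :
    (addDominating G).Adj 0 i := by
  refine ⟨hi.symm, ?_⟩
  rintro ⟨-, a, b, -, h, -⟩
  exact Fin.succ_ne_zero a h

theorem IsShifted.addIsolated {G : SimpleGraph (Fin n)} (hG : IsShifted G) :
    IsShifted (addIsolated G) := by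
  intro i j k hij hki h
  induction j using Fin.lastCases with
  | last => exact absurd h not_addIsolated_adj_last
  | cast j =>
    induction k using Fin.lastCases with
    | last => exact absurd h.symm not_addIsolated_adj_last
    | cast k =>
      induction i using Fin.lastCases with
      | last => exact absurd hij (not_lt.mpr (Fin.le_last _))
      | cast i =>
        rw [addIsolated_adj_castSucc] at h ⊢
        exact hG i j k (by simpa using hij) (by simpa using hki) h

theorem IsShifted.addDominating {G : SimpleGraph (Fin n)} (hG : IsShifted G) :
    IsShifted (addDominating G) := by
  intro i j k hij hki h
  induction i using Fin.cases with
  | zero => exact addDominating_adj_zero hki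
  | succ i =>
    induction k using Fin.cases with
    | zero => exact (addDominating_adj_zero (Fin.succ_ne_zero i)).symm
    | succ k =>
      induction j using Fin.cases with
      | zero => exact absurd hij (not_lt.mpr (Fin.zero_le _))
      | succ j =>
        rw [addDominating_adj_succ] at h ⊢
        exact hG i j k (by simpa using hij) (by simpa using hki) h

theorem IsShifted.exists_addDominating_eq {G : SimpleGraph (Fin (n + 2))} (hG : IsShifted G)
    (h : G.Adj 0 (Fin.last (n + 1))) : ∃ H, IsShifted H ∧ DegreePartition.addDominating H = G := by
  have hdom : ∀ i, i ≠ 0 → G.Adj 0 i := by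
    intro i hi
    rcases (Fin.le_last i).eq_or_lt with rfl | hlt
    · exact h
    · exact (hG i _ 0 hlt hi.symm h.symm).symm
  refine ⟨G.comap Fin.succ, fun i j k hij hki hjk => ?_, ?_⟩
  · exact hG _ _ _ (by simpa using hij) (by simpa using hki) hjk
  · ext i j
    induction i using Fin.cases with
    | zero =>
      by_cases hj : j = 0
      · simp [hj]
      · exact iff_of_true (addDominating_adj_zero hj) (hdom j hj)
    | succ i =>
      induction j using Fin.cases with
      | zero =>
        exact iff_of_true (addDominating_adj_zero (Fin.succ_ne_zero i)).symm
          (hdom _ (Fin.succ_ne_zero i)).symm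
      | succ j => rw [addDominating_adj_succ, SimpleGraph.comap_adj]

theorem IsShifted.exists_addIsolated_eq {G : SimpleGraph (Fin (n + 2))} (hG : IsShifted G)
    (h : ¬ G.Adj 0 (Fin.last (n + 1))) : ∃ H, IsShifted H ∧ DegreePartition.addIsolated H = G := by
  have hiso : ∀ i, ¬ G.Adj (Fin.last (n + 1)) i := by
    intro i hi
    rcases (Fin.zero_le i).eq_or_lt with rfl | hlt
    · exact h hi.symm
    · exact h (hG 0 i _ hlt (Fin.last_pos).ne' hi.symm)
  refine ⟨G.comap Fin.castSucc, fun i j k hij hki hjk => ?_, ?_⟩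
  · exact hG _ _ _ (by simpa using hij) (by simpa using hki) hjk
  · ext i j
    induction i using Fin.lastCases with
    | last => exact iff_of_false not_addIsolated_adj_last (hiso j)
    | cast i =>
      induction j using Fin.lastCases with
      | last =>
        exact iff_of_false (fun h => not_addIsolated_adj_last h.symm) fun h => hiso _ h.symm
      | cast j => rw [addIsolated_adj_castSucc, SimpleGraph.comap_adj]

/-- The pair {0, last} decides: as an edge it forces 0 to dominate, as a non-edge it isolates the
last vertex. Two vertices are needed to make 0 and last distinct. -/
theorem setOf_isShifted_add_two :
    {G : SimpleGraph (Fin (n + 2)) | IsShifted G} =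
      addIsolated '' {G : SimpleGraph (Fin (n + 1)) | IsShifted G} ∪
      addDominating '' {G : SimpleGraph (Fin (n + 1)) | IsShifted G} := by
  ext G
  constructor
  · intro hG
    by_cases h : G.Adj 0 (Fin.last (n + 1))
    · exact .inr (IsShifted.exists_addDominating_eq hG h)
    · exact .inl (IsShifted.exists_addIsolated_eq hG h)
  · rintro (⟨H, hH, rfl⟩ | ⟨H, hH, rfl⟩)
    · exact IsShifted.addIsolated hH
    · exact IsShifted.addDominating hH

theorem ncard_setOf_isShifted (n : ℕ) :
    {G : SimpleGraph (Fin (n + 1)) | IsShifted G}.ncard = 2 ^ n := by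
  induction n with
  | zero =>
    have hsub : Subsingleton (Fin (0 + 1)) := inferInstanceAs (Subsingleton (Fin 1))
    rw [pow_zero, Set.ncard_eq_one]
    refine ⟨⊥, Set.ext fun G => ?_⟩
    have hbot : G = ⊥ := by
      ext i j
      simp [Subsingleton.elim i j]
    refine ⟨fun _ => hbot, fun _ i j k hij => ?_⟩
    exact absurd hij (Subsingleton.elim i j ▸ lt_irrefl _)
  | succ n ih =>
    rw [setOf_isShifted_add_two, Set.ncard_union_eq ?_ (Set.toFinite _) (Set.toFinite _),
      Set.ncard_image_of_injective _ addIsolated_injective,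
      Set.ncard_image_of_injective _ addDominating_injective, ih]
    · ring
    · rw [Set.disjoint_left]
      rintro _ ⟨H, -, rfl⟩ ⟨H', -, h⟩
      have h1 : (addIsolated H).Adj 0 (Fin.last (n + 1)) :=
        h ▸ addDominating_adj_zero (Fin.last_pos).ne'
      exact not_addIsolated_adj_last h1.symm

theorem ncard_shiftedDegrees (n : ℕ) : (shiftedDegrees (n + 1)).ncard = 2 ^ n := by
  have hinj : Set.InjOn (fun G => rowSum (Fin (n + 1)) (indicator G)) {G | IsShifted G} :=
    fun G hG H _ h => IsShifted.eq_of_rowSum_eq hG h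
  rw [shiftedDegrees, hinj.ncard_image, ncard_setOf_isShifted]

/-- Passing from n to n + 1 adds the n + 2 pairs with k + l = n + 1. -/
theorem two_mul_card_fhmIndices (n : ℕ) : 2 * (fhmIndices n).card = n * (n + 3) := by
  induction n with
  | zero => rfl
  | succ n ih =>
    have h : fhmIndices (n + 1) =
        (fhmIndices n).disjUnion (Finset.HasAntidiagonal.antidiagonal (n + 1)) (by
          rw [Finset.disjoint_left]
          intro p hp
          simp only [fhmIndices, Finset.mem_filter] at hp
          rw [Finset.HasAntidiagonal.mem_antidiagonal]
          omega) := by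
      ext p
      simp only [fhmIndices, Finset.mem_filter, Finset.mem_product, Finset.mem_range,
        Finset.mem_disjUnion, Finset.HasAntidiagonal.mem_antidiagonal]
      omega
    rw [h, Finset.card_disjUnion, mul_add, ih, Finset.Nat.card_antidiagonal]
    ring

end Count

/-! ### The order polytope -/

section OrderPolytope

variable {n : ℕ}

theorem incidenceMatrix_mulVec {w : Fin n → Fin n → ℝ} (hs : ∀ i j, w i j = w j i)
    (hd : ∀ i, w i i = 0) :
    (incidenceMatrix n).mulVec (fun e => w e.val.1 e.val.2) = rowSum (Fin n) w := by
  ext i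
  have h1 : (incidenceMatrix n).mulVec (fun e => w e.val.1 e.val.2) i =
      ∑ p : Fin n × Fin n with p.1 < p.2, if i = p.1 ∨ i = p.2 then w p.1 p.2 else 0 := by
    rw [Finset.sum_subtype (p := fun p : Fin n × Fin n => p.1 < p.2)
      (F := inferInstanceAs (Fintype (TwoSubset n))) _ (by simp)]
    simp [Matrix.mulVec, dotProduct, incidenceMatrix]
  -- A pair containing `i` has it either as its smaller or as its larger element; these give the
  -- parts of row `i` right and left of the diagonal.
  have h2 : ∀ a b : Fin n, (if a < b then if i = a ∨ i = b then w a b else 0 else 0) =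
      (if i = a then if i < b then w i b else 0 else 0) +
        if i = b then if a < i then w i a else 0 else 0 := by
    intro a b
    by_cases ha : i = a
    · subst ha
      by_cases hb : i = b
      · subst hb
        simp
      · simp [hb]
    · by_cases hb : i = b
      · subst hb
        simp [ha, hs a i]
      · simp [ha, hb]
  rw [h1, Finset.sum_filter, Fintype.sum_prod_type]
  simp only [h2, Finset.sum_add_distrib]
  rw [Finset.sum_comm]
  simp only [Finset.sum_ite_eq, Finset.mem_univ, if_true]
  rw [rowSum_apply, ← Finset.sum_add_distrib]
  refine Finset.sum_congr rfl fun j _ => ?_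
  rcases lt_trichotomy i j with h | h | h
  · simp [h, not_lt.mpr h.le]
  · simp [h, hd]
  · simp [h, not_lt.mpr h.le]

/-- The symmetric matrix with given entries above the diagonal. -/
noncomputable def symmetrize (y : TwoSubset n → ℝ) (i j : Fin n) : ℝ :=
  if h : i < j then y ⟨(i, j), h⟩ else if h : j < i then y ⟨(j, i), h⟩ else 0

theorem symmetrize_comm (y : TwoSubset n → ℝ) (i j : Fin n) :
    symmetrize y i j = symmetrize y j i := by
  unfold symmetrize
  rcases lt_trichotomy i j with h | h | h
  · simp [h, not_lt.mpr h.le]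
  · simp [h]
  · simp [h, not_lt.mpr h.le]

theorem symmetrize_of_lt (y : TwoSubset n → ℝ) {i j : Fin n} (h : i < j) :
    symmetrize y i j = y ⟨(i, j), h⟩ := dif_pos h

theorem symmetrize_mem_shiftedFractionalGraphs {y : TwoSubset n → ℝ}
    (hy : y ∈ orderPolytope (TwoSubset n)) : symmetrize y ∈ shiftedFractionalGraphs n := by
  obtain ⟨hanti, hb⟩ := hy
  have hle : ∀ p q : TwoSubset n, p ≤ q → y q ≤ y p := fun p q h =>
    h.eq_or_lt.elim (fun h => h ▸ le_rfl) (hanti p q)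
  refine ⟨⟨symmetrize_comm y, fun i => by simp [symmetrize], fun i j => ?_⟩,
    fun i j k hij hki hkj => ?_⟩
  · unfold symmetrize
    split_ifs
    · exact hb _
    · exact hb _
    · norm_num
  · rcases lt_or_gt_of_ne hki with h | h
    · rw [symmetrize_comm y j, symmetrize_comm y i, symmetrize_of_lt y h,
        symmetrize_of_lt y (h.trans hij)]
      exact hle _ _ ⟨le_rfl, hij.le⟩
    · rw [symmetrize_of_lt y h]
      rcases lt_or_gt_of_ne hkj with h' | h'
      · rw [symmetrize_comm, symmetrize_of_lt y h']
        exact hle _ _ ⟨h.le, h'.le⟩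
      · rw [symmetrize_of_lt y h']
        exact hle _ _ ⟨hij.le, le_rfl⟩

theorem restrict_mem_orderPolytope {w : Fin n → Fin n → ℝ} (hw : w ∈ shiftedFractionalGraphs n) :
    (fun e : TwoSubset n => w e.val.1 e.val.2) ∈ orderPolytope (TwoSubset n) := by
  obtain ⟨⟨hs, -, hb⟩, hm⟩ := hw
  have hle : ∀ i j k, i ≤ j → k ≠ i → k ≠ j → w j k ≤ w i k := by
    intro i j k hij hi hj
    rcases hij.eq_or_lt with rfl | hij
    · exact le_rfl
    · exact hm i j k hij hi hj
  refine ⟨?_, fun p => hb _ _⟩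
  rintro ⟨⟨i, j⟩, hij⟩ ⟨⟨i', j'⟩, hij'⟩ h
  obtain ⟨h1, h2⟩ : i ≤ i' ∧ j ≤ j' := h.le
  change i < j at hij
  change i' < j' at hij'
  change w i' j' ≤ w i j
  -- Change one coordinate at a time; the intermediate pair (i, j') is off the diagonal because i ≤
  -- i' < j'.
  calc w i' j' ≤ w i j' := hle i i' j' h1 (h1.trans_lt hij').ne' hij'.ne'
    _ = w j' i := hs _ _
    _ ≤ w j i := hle j j' i h2 hij.ne (hij.trans_le h2).ne
    _ = w i j := hs _ _

/-- Symmetrizing and restricting to entries above the diagonal translate between the two sets,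
compatibly with the two linear maps. -/
theorem incidenceMatrix_image_orderPolytope :
    (fun y : TwoSubset n → ℝ => (incidenceMatrix n).mulVec y) '' orderPolytope (TwoSubset n) =
      rowSum (Fin n) '' shiftedFractionalGraphs n := by
  ext x
  constructor
  · rintro ⟨y, hy, rfl⟩
    have hw := symmetrize_mem_shiftedFractionalGraphs hy
    refine ⟨symmetrize y, hw, ?_⟩
    rw [← incidenceMatrix_mulVec hw.1.1 hw.1.2.1]
    congr 1
    ext e
    exact symmetrize_of_lt y e.2
  · rintro ⟨w, hw, rfl⟩
    exact ⟨_, restrict_mem_orderPolytope hw, incidenceMatrix_mulVec hw.1.1 hw.1.2.1⟩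

end OrderPolytope

end DegreePartition

theorem mainTheorem1 (n : ℕ) (hn : 1 ≤ n) :
    DegreePartition.degreePartitionPolytope n = DegreePartition.fhmPolytope n ∧
    2 * (DegreePartition.fhmIndices n).card = n * (n + 3) ∧
    Set.extremePoints ℝ (DegreePartition.degreePartitionPolytope n) =
      DegreePartition.thresholdPartitions n ∧
    (Set.extremePoints ℝ (DegreePartition.degreePartitionPolytope n)).ncard = 2 ^ (n - 1) ∧
    (fun y : DegreePartition.TwoSubset n → ℝ =>
        (DegreePartition.incidenceMatrix n).mulVec y) ''
      DegreePartition.orderPolytope (DegreePartition.TwoSubset n) =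
        DegreePartition.degreePartitionPolytope n := by
  have h := DegreePartition.degreePartitionPolytope_eq_fhmPolytope (n := n)
  refine ⟨h, DegreePartition.two_mul_card_fhmIndices n, ?_, ?_, ?_⟩
  · rw [h, DegreePartition.extremePoints_fhmPolytope]
  · obtain ⟨m, rfl⟩ := Nat.exists_eq_add_of_le' hn
    rw [h, DegreePartition.extremePoints_fhmPolytope,
      DegreePartition.thresholdPartitions_eq_shiftedDegrees,
      DegreePartition.ncard_shiftedDegrees, Nat.add_sub_cancel]
  · rw [h, DegreePartition.incidenceMatrix_image_orderPolytope,
      DegreePartition.rowSum_image_shiftedFractionalGraphs]
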